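/- Let $g\ge 2$ be an integer and let $\mathbb N_0=\{0,1,2,\dots\}$. A subshift $\Sigma\subseteq\{0,\dots,g-1\}^{\mathbb N_0}$ is a closed set (for the product of the discrete topologies) that is mapped into itself by the left shift; its language $\mathcal L(\Sigma)$ is the set of all finite words $x_0x_1\cdots x_{n-1}$ ($n\ge 0$) with $(x_j)_{j\ge0}\in\Sigma$. The subshift $\Sigma$ is transitive if for all $u,v\in\mathcal L(\Sigma)$ there is $w\in\mathcal L(\Sigma)$ with $uwv\in\mathcal L(\Sigma)$, and sofic if it is the set of label sequences of all infinite paths of some finite directed multigraph whose edges are labelled by $\{0,\dots,g-1\}$. For a word $w=w_0\cdots w_{n-1}$ put $|w|=n$ and $(w)_g=w_0+w_1g+\cdots+w_{n-1}g^{n-1}$, and let $A_\Sigma=\{(w)_g: w\in\mathcal L(\Sigma)\}\subseteq\mathbb N_0$. For $A\subseteq\mathbb N_0$, the lower and upper mass dimensions of $A$ are the $\liminf$ and $\limsup$ of $\log|A\cap[0,N)|/\log N$ as $N\to\infty$ (both are $0$ for $A=\emptyset$); if they agree, the mass dimension $\dim_{\mathrm M}(A)$ exists and is their common value. **Theorem.**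 Let $\Sigma\subseteq\{0,\dots,g-1\}^{\mathbb N_0}$ be a transitive sofic subshift. Then $\dim_{\mathrm M}(A_\Sigma)$ exists, and for all integers $a\ge 1$ and $b\ge 0$, with $P=a\mathbb N_0+b=\{ak+b:k\in\mathbb N_0\}$: 1. If there is a word $w\in\mathcal L(\Sigma)$ with $|w|\ge a-1$ and $(w)_g\equiv b \pmod a$, then $\dim_{\mathrm M}(A_\Sigma\cap P)$ exists and $\dim_{\mathrm M}(A_\Sigma\cap P)=\dim_{\mathrm M}(A_\Sigma)$. 2. If there is no such word, then $|A_\Sigma\cap P|\le g^a$. 3. Consequently, for every infinite arithmetic progression $P\subseteq\mathbb N_0$, the mass dimension $\dim_{\mathrm M}(A_\Sigma\cap P)$ exists and is either $0$ or $\dim_{\mathrm M}(A_\Sigma)$. -/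

import Mathlib

namespace MassDimSofic

open SymbolicDynamics.FullShift

/-- The language of a one-sided subshift `X` over the alphabet `{0, …, g-1}`: all finite words
`x₀ x₁ ⋯ xₙ₋₁` (with `n ≥ 0`) that are initial segments of points `x` of `X`. -/
def language {g : ℕ} (X : Subshift (Fin g) ℕ) : Set (List (Fin g)) :=
  {w | ∃ x ∈ X.carrier, ∃ n : ℕ, w = (List.range n).map x}

/-- Transitivity (irreducibility): any two words of the language can be joined by a word. -/
def IsTransitive {g : ℕ} (X : Subshift (Fin g) ℕ) : Prop :=
  ∀ u ∈ language X, ∀ v ∈ language X, ∃ w ∈ language X, u ++ w ++ v ∈ language X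

/-- A finite directed multigraph whose edges carry labels in `A`. -/
structure LabelledGraph (A : Type) where
  /-- the nodes -/
  V : Type
  /-- the edges -/
  E : Type
  finite_V : Finite V
  finite_E : Finite E
  /-- starting node of an edge -/
  source : E → V
  /-- terminal node of an edge -/
  target : E → V
  /-- label of an edge -/
  label : E → A

/-- The label sequences of the infinite paths of a labelled graph. -/
def LabelledGraph.sequences {A : Type} (G : LabelledGraph A) : Set (ℕ → A) :=
  {x | ∃ e : ℕ → G.E, (∀ j, G.source (e (j + 1)) = G.target (e j)) ∧ ∀ j, x j = G.label (e j)}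

/-- A subshift is sofic if it is presented by some finite labelled graph. -/
def IsSofic {g : ℕ} (X : Subshift (Fin g) ℕ) : Prop :=
  ∃ G : LabelledGraph (Fin g), X.carrier = G.sequences

/-- The integer `(w)_g = w₀ + w₁ g + ⋯ + wₙ₋₁ gⁿ⁻¹` (the last letter is the most significant
digit; the empty word represents `0`). -/
def wordValue {g : ℕ} (w : List (Fin g)) : ℕ :=
  Nat.ofDigits g (w.map Fin.val)

/-- The `g`-language set `A_X = {(w)_g : w ∈ language X}`. -/
def languageSet {g : ℕ} (X : Subshift (Fin g) ℕ) : Set ℕ :=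
  wordValue '' language X

/-- The infinite arithmetic progression `{a k + b : k = 0, 1, 2, …}`. -/
def progression (a b : ℕ) : Set ℕ :=
  {n | ∃ k : ℕ, n = a * k + b}

/-- `log |A ∩ [0, N)| / log N`. Since `Real.log 0 = 0`, this is `0` for every `N` when `A` is
empty, so that the empty set gets mass dimension `0`. -/
noncomputable def massRatio (A : Set ℕ) (N : ℕ) : ℝ :=
  Real.log ((A ∩ Set.Iio N).ncard : ℝ) / Real.log (N : ℝ)

/-- Lower mass dimension (for `N ≥ 2` the ratios lie in `[0, 1]`, so the real `liminf` is the
true one). -/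
noncomputable def lowerMassDim (A : Set ℕ) : ℝ :=
  Filter.liminf (massRatio A) Filter.atTop

/-- Upper mass dimension. -/
noncomputable def upperMassDim (A : Set ℕ) : ℝ :=
  Filter.limsup (massRatio A) Filter.atTop

/-- The mass dimension of `A` exists and equals `d`. -/
def HasMassDim (A : Set ℕ) (d : ℝ) : Prop :=
  lowerMassDim A = d ∧ upperMassDim A = d

end MassDimSofic

namespace MassDimSofic

open SymbolicDynamics.FullShift

/-! ### Follower sets, synchronizing words, and connections of bounded length -/

section Language

variable {g : ℕ} {X : Subshift (Fin g) ℕ}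

/-! Let p(n) count the words of length n. Fekete's lemma gives log p(n) / n → h, and p(n) ≤ |A ∩ [0,
gⁿ)| ≤ (n+1) p(n), so A has dimension h / log g (`tendsto_massRatio`).

For a progression only the lower bound needs work. Choose q coprime to g with a ∣ g^(a-1) q. A given
word w with |w| ≥ a-1 and value ≡ b is continued to w τ y v r, where v is an arbitrary word of
length n and q divides the value of τ y v r; the total value is then still ≡ b mod a. Divisibility
by q is a group condition: digits act on ℤ/q by affine permutations, and a word acting trivially has
value 0 mod q. A synchronizing τ permits repeating a loop until its action is trivial
(`exists_return`), and finiteness of the set of follower sets bounds |y| and |r| uniformly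
(`exists_bounded_connection`). Hence p(n) is at most a constant times the count in A ∩ P below
g^(n+const).

If no such w exists, elements of A ∩ P come only from short words, so they lie below g^a. -/

lemma mem_language_iff {w : List (Fin g)} :
    w ∈ language X ↔ ∃ x ∈ X.carrier, ∀ i (h : i < w.length), w[i] = x i := by
  constructor
  · rintro ⟨x, hx, n, rfl⟩
    exact ⟨x, hx, by simp⟩
  · rintro ⟨x, hx, h⟩
    exact ⟨x, hx, w.length, List.ext_getElem (by simp) (by simpa using h)⟩

lemma mem_language_append_iff {u v : List (Fin g)} :
    u ++ v ∈ language X ↔ ∃ x ∈ X.carrier, (∀ i (h : i < u.length), u[i] = x i) ∧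
      ∀ i (h : i < v.length), v[i] = x (u.length + i) := by
  rw [mem_language_iff]
  refine exists_congr fun x => and_congr_right fun _ => ⟨fun h => ⟨fun i hi => ?_, fun i hi => ?_⟩,
    fun h i hi => ?_⟩
  · rw [← h i (by simp; omega), List.getElem_append_left hi]
  · rw [← h (u.length + i) (by simp; omega), List.getElem_append_right (by omega)]
    simp
  · by_cases hiu : i < u.length
    · rw [List.getElem_append_left hiu, h.1 i hiu]
    · rw [List.getElem_append_right (by omega), h.2]
      congr 1
      omega

lemma language_of_append_left {u v : List (Fin g)} (h : u ++ v ∈ language X) :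
    u ∈ language X := by
  obtain ⟨x, hx, h1, -⟩ := mem_language_append_iff.1 h
  exact mem_language_iff.2 ⟨x, hx, h1⟩

lemma language_of_append_right {u v : List (Fin g)} (h : u ++ v ∈ language X) :
    v ∈ language X := by
  obtain ⟨x, hx, -, h2⟩ := mem_language_append_iff.1 h
  exact mem_language_iff.2 ⟨_, X.mapsTo u.length hx, h2⟩

lemma exists_append_mem_language {w : List (Fin g)} (hw : w ∈ language X) (k : ℕ) :
    ∃ v : List (Fin g), v.length = k ∧ w ++ v ∈ language X := by
  obtain ⟨x, hx, h⟩ := mem_language_iff.1 hw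
  exact ⟨(List.range k).map fun i => x (w.length + i), by simp,
    mem_language_append_iff.2 ⟨x, hx, h, by simp⟩⟩

/-- The words that may follow `u`. -/
def follower (X : Subshift (Fin g) ℕ) (u : List (Fin g)) : Set (List (Fin g)) :=
  {v | u ++ v ∈ language X}

/-- The nodes at which a path labelled by `u` may be when it goes on. -/
def terminalNodes (G : LabelledGraph (Fin g)) (u : List (Fin g)) : Set G.V :=
  {q | ∃ e : ℕ → G.E, (∀ j, G.source (e (j + 1)) = G.target (e j)) ∧
    (∀ i (h : i < u.length), u[i] = G.label (e i)) ∧ G.source (e u.length) = q}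

/-- Paths can be spliced at a common node, so a follower set depends only on the set of terminal
nodes, one of finitely many subsets. -/
lemma finite_range_follower (hX : IsSofic X) : (Set.range (follower X)).Finite := by
  obtain ⟨G, hG⟩ := hX
  have := G.finite_V
  let ψ : Set G.V → Set (List (Fin g)) := fun T =>
    {v | ∃ q ∈ T, ∃ e : ℕ → G.E, (∀ j, G.source (e (j + 1)) = G.target (e j)) ∧
      (∀ i (h : i < v.length), v[i] = G.label (e i)) ∧ G.source (e 0) = q}
  have key : ∀ u, follower X u = ψ (terminalNodes G u) := by
    intro u
    ext v
    simp only [follower, Set.mem_ofPred_eq, mem_language_append_iff, hG, LabelledGraph.sequences,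
      terminalNodes, ψ]
    constructor
    · rintro ⟨x, ⟨e, he, hxe⟩, h1, h2⟩
      refine ⟨_, ⟨e, he, fun i hi => by rw [h1 i hi, hxe], rfl⟩, fun j => e (u.length + j),
        fun j => he _, fun i hi => by rw [h2 i hi, hxe], rfl⟩
    · rintro ⟨q, ⟨e, he, h1, hq⟩, e', he', h2, hq'⟩
      let e'' : ℕ → G.E := fun j => if j < u.length then e j else e' (j - u.length)
      refine ⟨fun j => G.label (e'' j), ⟨e'', fun j => ?_, fun j => rfl⟩, fun i hi => ?_,
        fun i hi => ?_⟩
      · rcases lt_trichotomy (j + 1) u.length with hj | hj | hj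
        · simp only [e'', hj, if_true, show j < u.length by omega, he]
        · simp only [e'', show j < u.length by omega, if_true, ← he, hj, lt_irrefl, if_false,
            Nat.sub_self, hq, hq']
        · simp only [e'', show ¬ j < u.length by omega, show ¬ j + 1 < u.length by omega, if_false,
            ← he', show j + 1 - u.length = j - u.length + 1 by omega]
      · simp only [e'', hi, if_true, h1]
      · simp [e'', h2]
  refine (Set.finite_range ψ).subset ?_
  rintro _ ⟨u, rfl⟩
  exact ⟨_, (key u).symm⟩

/-- Overlapping words of the language can be glued along `τ`. -/
def IsSynchronizing (X : Subshift (Fin g) ℕ) (τ : List (Fin g)) : Prop :=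
  ∀ x y, x ++ τ ∈ language X → τ ++ y ∈ language X → x ++ τ ++ y ∈ language X

/-- Extending a word to the left can only shrink its follower set, so a word with inclusion-minimal
follower set synchronizes. -/
lemma exists_synchronizing (hX : IsSofic X) (hne : (language X).Nonempty) :
    ∃ τ ∈ language X, IsSynchronizing X τ := by
  have hfin : (follower X '' language X).Finite :=
    (finite_range_follower hX).subset (Set.image_subset_range _ _)
  obtain ⟨_, ⟨u, hu, rfl⟩, hmin⟩ := hfin.exists_minimal (hne.image _)
  refine ⟨u, hu, fun x y hx hy => ?_⟩
  have hle : follower X (x ++ u) ≤ follower X u := fun v hv => by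
    refine language_of_append_right (u := x) ?_
    rw [← List.append_assoc]
    exact hv
  exact hmin ⟨_, hx, rfl⟩ hle hy

lemma IsSynchronizing.append_left {τ : List (Fin g)} (h : IsSynchronizing X τ)
    (t : List (Fin g)) : IsSynchronizing X (t ++ τ) := fun x y hx hy => by
  have := h (x ++ t) y (by simpa using hx)
    (language_of_append_right (u := t) (by simpa using hy))
  simpa using this

lemma exists_uniform_length_bound {α β γ : Type*} (f : α → β) (hf : (Set.range f).Finite)
    (P : α → Prop) (Q : α → List γ → Prop) (hQ : ∀ a a' r, f a = f a' → Q a r → Q a' r)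
    (h : ∀ a, P a → ∃ r, Q a r) : ∃ K : ℕ, ∀ a, P a → ∃ r, r.length ≤ K ∧ Q a r := by
  have h' : ∀ s : β, ∃ r : List γ, ∀ a, P a → f a = s → Q a r := by
    intro s
    by_cases hs : ∃ a, P a ∧ f a = s
    · obtain ⟨a, ha, rfl⟩ := hs
      obtain ⟨r, hr⟩ := h a ha
      exact ⟨r, fun a' _ haa' => hQ a a' r haa'.symm hr⟩
    · exact ⟨[], fun a ha has => (hs ⟨a, ha, has⟩).elim⟩
  choose r hr using h'
  obtain ⟨K, hK⟩ := (hf.image fun s => (r s).length).bddAbove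
  exact ⟨K, fun a ha => ⟨r (f a), hK ⟨f a, ⟨a, rfl⟩, rfl⟩, hr _ a ha rfl⟩⟩

/-- Transitivity leads back to `τ` through a loop `c = τ z s`, which synchronization allows to be
repeated; as many copies as the order of its product give the identity. -/
lemma exists_return {H : Type*} [Group H] [Finite H] (δ : Fin g → H) (htrans : IsTransitive X)
    {w τ z : List (Fin g)} (hτ : IsSynchronizing X τ) (h : w ++ τ ++ z ∈ language X) :
    ∃ r, w ++ τ ++ z ++ r ∈ language X ∧ ((τ ++ z ++ r).map δ).prod = 1 := by
  have hτL : τ ∈ language X := language_of_append_right (language_of_append_left h)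
  obtain ⟨s, -, hs⟩ := htrans _ h _ hτL
  set c := τ ++ z ++ s with hc
  have hcτ : c ++ τ ∈ language X :=
    language_of_append_right (u := w) (by simpa [hc] using hs)
  have hpow : ∀ k : ℕ, w ++ (List.replicate k c).flatten ++ τ ∈ language X := by
    intro k
    induction k with
    | zero => exact language_of_append_left (v := z) (by simpa using h)
    | succ k ih =>
      have := hτ _ (z ++ s ++ τ) ih (by simpa [hc] using hcτ)
      rw [List.replicate_succ']
      simpa [hc] using this
  obtain ⟨k, hk⟩ : ∃ k, orderOf ((c.map δ).prod) = k + 1 :=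
    ⟨_, (Nat.succ_pred_eq_of_pos (orderOf_pos _)).symm⟩
  refine ⟨s ++ (List.replicate k c).flatten, ?_, ?_⟩
  · have := language_of_append_left (hpow (k + 1))
    rw [List.replicate_succ] at this
    simpa [hc] using this
  · have h1 : τ ++ z ++ (s ++ (List.replicate k c).flatten) = (List.replicate (k + 1) c).flatten := by
      rw [List.replicate_succ]; simp [hc]
    have h2 : ∀ k, (((List.replicate k c).flatten).map δ).prod = (c.map δ).prod ^ k := by
      intro k
      induction k with
      | zero => simp
      | succ k ih => rw [List.replicate_succ, List.flatten_cons, List.map_append,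
          List.prod_append, ih, pow_succ']
    rw [h1, h2, ← hk, pow_orderOf_eq_one]

lemma exists_bounded_connection {H : Type*} [Group H] [Finite H] (δ : Fin g → H)
    (htrans : IsTransitive X) (hX : IsSofic X) {w : List (Fin g)} (hw : w ∈ language X) :
    ∃ (τ : List (Fin g)) (K : ℕ), ∀ v ∈ language X, ∃ y r : List (Fin g), y.length ≤ K ∧
      r.length ≤ K ∧ w ++ (τ ++ y ++ v ++ r) ∈ language X ∧
      ((τ ++ y ++ v ++ r).map δ).prod = 1 := by
  obtain ⟨τ₀, hτ₀, hsync₀⟩ := exists_synchronizing hX ⟨w, hw⟩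
  -- Prepending `t` keeps the word synchronizing and makes it a legal continuation of `w`.
  obtain ⟨t, -, ht⟩ := htrans w hw τ₀ hτ₀
  have hsync := hsync₀.append_left t
  rw [List.append_assoc] at ht
  set τ := t ++ τ₀
  have hF := finite_range_follower hX
  -- Whether `y` connects to `v` depends on `v` only through the collection of follower sets
  -- containing it.
  obtain ⟨K₁, hK₁⟩ := exists_uniform_length_bound (γ := Fin g)
    (f := fun v : List (Fin g) => {S : Set.range (follower X) | v ∈ S.1})
    (by have := hF.to_subtype; exact Set.toFinite _)
    (P := fun v => v ∈ language X) (Q := fun v y => w ++ τ ++ y ++ v ∈ language X)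
    (fun v v' y hvv' h => by
      have : (⟨follower X (w ++ τ ++ y), _, rfl⟩ : Set.range (follower X)) ∈
        {S : Set.range (follower X) | v ∈ S.1} := h
      rw [show {S : Set.range (follower X) | v ∈ S.1} = _ from hvv'] at this
      exact this)
    (fun v hv => (htrans _ ht v hv).imp fun y h => h.2)
  obtain ⟨K₂, hK₂⟩ := exists_uniform_length_bound (γ := Fin g)
    (f := fun z : List (Fin g) => (follower X (w ++ τ ++ z), ((τ ++ z).map δ).prod))
    ((hF.prod (Set.finite_univ (α := H))).subset (by rintro _ ⟨z, rfl⟩; exact ⟨⟨_, rfl⟩, trivial⟩))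
    (P := fun z => w ++ τ ++ z ∈ language X)
    (Q := fun z r => w ++ τ ++ z ++ r ∈ language X ∧ ((τ ++ z ++ r).map δ).prod = 1)
    (fun z z' r hzz' h => by
      obtain ⟨h1, h2⟩ := Prod.mk.inj hzz'
      refine ⟨?_, ?_⟩
      · change r ∈ follower X _
        rw [← h1]
        exact h.1
      · rw [List.map_append, List.prod_append, ← h2, ← List.prod_append, ← List.map_append]
        exact h.2)
    (fun z hz => exists_return δ htrans hsync hz)
  refine ⟨τ, max K₁ K₂, fun v hv => ?_⟩
  obtain ⟨y, hyK, hy⟩ := hK₁ v hv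
  obtain ⟨r, hrK, hr, hr'⟩ := hK₂ (y ++ v) (by simpa using hy)
  exact ⟨y, r, hyK.trans (le_max_left _ _), hrK.trans (le_max_right _ _), by simpa using hr,
    by simpa using hr'⟩

end Language

/-! ### Word values and their residues -/

section WordValue

variable {g : ℕ}

lemma wordValue_append (u v : List (Fin g)) :
    wordValue (u ++ v) = wordValue u + g ^ u.length * wordValue v := by
  simp [wordValue, Nat.ofDigits_append]

lemma wordValue_lt (hg : 2 ≤ g) (w : List (Fin g)) : wordValue w < g ^ w.length := by
  have := Nat.ofDigits_lt_base_pow_length (b := g) (l := w.map Fin.val) hg (by simp)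
  simpa [wordValue] using this

lemma wordValue_injOn (hg : 2 ≤ g) {u v : List (Fin g)} (hl : u.length = v.length)
    (h : wordValue u = wordValue v) : u = v := by
  refine List.map_injective_iff.2 Fin.val_injective
    (Nat.ofDigits_inj_of_len_eq (b := g) hg (by simpa using hl) ?_ ?_ h) <;> simp

/-- The affine permutation `x ↦ i + g x` of `ZMod q`. -/
def digitPerm {q : ℕ} (hq : g.Coprime q) (i : Fin g) : Equiv.Perm (ZMod q) :=
  (Units.mulLeft (ZMod.unitOfCoprime g hq)).trans (Equiv.addLeft ((i : ℕ) : ZMod q))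

lemma prod_digitPerm_apply {q : ℕ} (hq : g.Coprime q) (w : List (Fin g)) (x : ZMod q) :
    (w.map (digitPerm hq)).prod x = (wordValue w : ZMod q) + (g : ZMod q) ^ w.length * x := by
  induction w with
  | nil => simp [wordValue]
  | cons i w ih =>
    have : wordValue (i :: w) = i + g * wordValue w := by
      simp [wordValue, Nat.ofDigits_cons]
    simp only [List.map_cons, List.prod_cons, Equiv.Perm.mul_apply, ih, this]
    simp [digitPerm, pow_succ]
    ring

lemma dvd_wordValue_of_prod_eq_one {q : ℕ} (hq : g.Coprime q) {w : List (Fin g)}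
    (h : (w.map (digitPerm hq)).prod = 1) : q ∣ wordValue w := by
  have := prod_digitPerm_apply hq w 0
  rw [h] at this
  rw [← ZMod.natCast_eq_zero_iff]
  simpa using this.symm

/-- Dividing `a` by `g.gcd a ≥ 2` costs one factor `g` and lowers `a` by at least one, so `a - 1`
factors suffice. -/
lemma exists_coprime_dvd_pow_mul (g a : ℕ) (ha : 1 ≤ a) :
    ∃ q, 1 ≤ q ∧ g.Coprime q ∧ a ∣ g ^ (a - 1) * q := by
  induction a using Nat.strong_induction_on with
  | _ a ih =>
  by_cases h : g.Coprime a
  · exact ⟨a, ha, h, dvd_mul_left _ _⟩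
  · set d := g.gcd a with hd
    obtain ⟨a', ha'⟩ : d ∣ a := Nat.gcd_dvd_right _ _
    have hd2 : 2 ≤ d := by
      have : d ≠ 1 := h
      have : 0 < d := Nat.gcd_pos_of_pos_right _ ha
      omega
    have ha'1 : 1 ≤ a' := by
      rcases Nat.eq_zero_or_pos a' with h0 | h0
      · simp [h0] at ha'; omega
      · exact h0
    have hlt : a' < a := by nlinarith
    obtain ⟨q, hq1, hq, hdvd⟩ := ih a' hlt ha'1
    refine ⟨q, hq1, hq, ?_⟩
    have h1 : a ∣ g * (g ^ (a' - 1) * q) := by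
      conv_lhs => rw [ha']
      exact mul_dvd_mul (Nat.gcd_dvd_left _ _) hdvd
    refine h1.trans ?_
    rw [← mul_assoc, ← pow_succ']
    exact mul_dvd_mul_right (pow_dvd_pow _ (by omega)) _

end WordValue

/-! ### Comparing word counts with counting functions -/

section Counting

variable {g : ℕ} {X : Subshift (Fin g) ℕ}

/-- The words of length `n` of the language. -/
def wordsOfLength (X : Subshift (Fin g) ℕ) (n : ℕ) : Set (List (Fin g)) :=
  {w | w ∈ language X ∧ w.length = n}

lemma finite_wordsOfLength (n : ℕ) : (wordsOfLength X n).Finite :=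
  (List.finite_length_eq (Fin g) n).subset fun _ h => h.2

lemma ncard_wordsOfLength_pos (hne : (language X).Nonempty) (n : ℕ) :
    1 ≤ (wordsOfLength X n).ncard := by
  refine (Set.ncard_pos (finite_wordsOfLength n)).2 ?_
  obtain ⟨w, hw⟩ := hne
  obtain ⟨v, hv, hwv⟩ := exists_append_mem_language hw n
  exact ⟨v, language_of_append_right hwv, hv⟩

lemma ncard_wordsOfLength_add_le (m n : ℕ) :
    (wordsOfLength X (m + n)).ncard ≤ (wordsOfLength X m).ncard * (wordsOfLength X n).ncard := by
  rw [← Set.ncard_prod]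
  refine Set.ncard_le_ncard_of_injOn (fun w => (w.take m, w.drop m)) ?_ ?_
    ((finite_wordsOfLength m).prod (finite_wordsOfLength n))
  · rintro w ⟨hw, hl⟩
    rw [← List.take_append_drop m w] at hw
    exact ⟨⟨language_of_append_left hw, by simp [hl]⟩, ⟨language_of_append_right hw, by simp [hl]⟩⟩
  · intro w _ w' _ h
    obtain ⟨h1, h2⟩ := Prod.mk.inj h
    rw [← List.take_append_drop m w, h1, h2, List.take_append_drop]

/-- Short words extend to length `n`, and long ones have only zeros beyond position `n`; so each
element is the value of one of the `n + 1` prefixes of a word of length `n`. -/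
lemma ncard_languageSet_inter_le (n : ℕ) :
    (languageSet X ∩ Set.Iio (g ^ n)).ncard ≤ (n + 1) * (wordsOfLength X n).ncard := by
  have hfin : (Set.Iic n ×ˢ wordsOfLength X n).Finite :=
    (Set.finite_Iic n).prod (finite_wordsOfLength n)
  have hsub : languageSet X ∩ Set.Iio (g ^ n) ⊆
      (fun kw : ℕ × List (Fin g) => wordValue (kw.2.take kw.1)) ''
        (Set.Iic n ×ˢ wordsOfLength X n) := by
    rintro _ ⟨⟨w, hw, rfl⟩, hlt⟩
    rcases le_total w.length n with hl | hl
    · obtain ⟨v, hv, hwv⟩ := exists_append_mem_language hw (n - w.length)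
      exact ⟨(w.length, w ++ v), ⟨hl, hwv, by simp [hv, hl]⟩, by simp⟩
    · refine ⟨(n, w.take n), ⟨Set.mem_Iic.2 le_rfl, ?_, by simp [hl]⟩, ?_⟩
      · rw [← List.take_append_drop n w] at hw
        exact language_of_append_left hw
      · have h := wordValue_append (w.take n) (w.drop n)
        rw [List.take_append_drop, List.length_take_of_le hl] at h
        have h0 : wordValue (w.drop n) = 0 := by
          by_contra h0
          have := Nat.mul_le_mul_left (g ^ n) (Nat.one_le_iff_ne_zero.2 h0)
          simp only [Set.mem_Iio] at hlt
          omega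
        change wordValue ((w.take n).take n) = wordValue w
        rw [h, h0, mul_zero, add_zero, List.take_take, min_self]
  calc _ ≤ _ := Set.ncard_le_ncard hsub (hfin.image _)
    _ ≤ _ := Set.ncard_image_le hfin
    _ = _ := by
      rw [Set.ncard_prod, ← Nat.card_coe_set_eq (Set.Iic n)]
      simp

lemma ncard_wordsOfLength_le (hg : 2 ≤ g) (n : ℕ) :
    (wordsOfLength X n).ncard ≤ (languageSet X ∩ Set.Iio (g ^ n)).ncard :=
  Set.ncard_le_ncard_of_injOn wordValue
    (fun w hw => ⟨⟨w, hw.1, rfl⟩, by have := wordValue_lt hg w; rwa [hw.2] at this⟩)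
    (fun _ hu _ hv h => wordValue_injOn hg (hu.2.trans hv.2.symm) h)
    ((Set.finite_Iio _).subset Set.inter_subset_right)

lemma ncard_wordsOfLength_le_of_modEq (hg : 2 ≤ g) (htrans : IsTransitive X) (hX : IsSofic X)
    {a b : ℕ} (ha : 1 ≤ a) {w : List (Fin g)} (hw : w ∈ language X) (hwl : a - 1 ≤ w.length)
    (hwb : wordValue w ≡ b [MOD a]) :
    ∃ c K : ℕ, 1 ≤ c ∧ ∀ n, (wordsOfLength X n).ncard ≤
      c * max 1 (languageSet X ∩ progression a b ∩ Set.Iio (g ^ (n + K))).ncard := by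
  obtain ⟨q, hq1, hq, hdvd⟩ := exists_coprime_dvd_pow_mul g a ha
  have : NeZero q := ⟨by omega⟩
  obtain ⟨τ, K, hK⟩ := exists_bounded_connection (digitPerm hq) htrans hX hw
  -- `K + 1` counts the possible lengths of `y`; `b + 1` absorbs the numbers below `b`, which may be
  -- ≡ `b` without lying in the progression.
  refine ⟨(K + 1) * (b + 1), w.length + τ.length + 2 * K, Nat.mul_pos K.succ_pos b.succ_pos,
    fun n => ?_⟩
  set M := n + (w.length + τ.length + 2 * K)
  set B := {k | k ∈ languageSet X ∧ k ≡ b [MOD a] ∧ k < g ^ M} with hB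
  have hBfin : B.Finite := (Set.finite_Iio (g ^ M)).subset fun k hk => hk.2.2
  have h1 : (wordsOfLength X n).ncard ≤ (Set.Iic K ×ˢ B).ncard := by
    choose! y r hy hr hL hprod using hK
    refine Set.ncard_le_ncard_of_injOn
      (fun v => ((y v).length, wordValue (w ++ (τ ++ y v ++ v ++ r v)))) ?_ ?_
      ((Set.finite_Iic K).prod hBfin)
    · rintro v ⟨hv, hvn⟩
      refine ⟨hy v hv, ⟨_, hL v hv, rfl⟩, ?_, (wordValue_lt hg _).trans_le
        (Nat.pow_le_pow_right (by omega) ?_)⟩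
      · rw [wordValue_append]
        have h2 : a ∣ g ^ w.length * wordValue (τ ++ y v ++ v ++ r v) :=
          hdvd.trans (mul_dvd_mul (pow_dvd_pow _ hwl)
            (dvd_wordValue_of_prod_eq_one hq (hprod v hv)))
        simpa using hwb.add ((Nat.modEq_zero_iff_dvd).2 h2)
      · have := hy v hv
        have := hr v hv
        simp only [List.length_append, M]
        omega
    · rintro v ⟨hv, hvn⟩ v' ⟨hv', hvn'⟩ h
      obtain ⟨hl, hval⟩ := Prod.mk.inj h
      -- The digits of `v` can be read off once its position, hence the length of `y`, is known.
      have key : ∀ p v s : List (Fin g), wordValue (p ++ v ++ s) / g ^ p.length % g ^ v.length =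
          wordValue v := by
        intro p v s
        rw [List.append_assoc, wordValue_append, wordValue_append,
          Nat.add_mul_div_left _ _ (by positivity), Nat.div_eq_of_lt (wordValue_lt hg p), zero_add,
          Nat.add_mul_mod_self_left, Nat.mod_eq_of_lt (wordValue_lt hg v)]
      refine wordValue_injOn hg (hvn.trans hvn'.symm) ?_
      rw [← key (w ++ τ ++ y v) v (r v), ← key (w ++ τ ++ y v') v' (r v')]
      simp only [List.append_assoc, List.length_append] at hval hl ⊢
      rw [hval, hl, hvn, hvn']
  have h2 : B.ncard ≤ (languageSet X ∩ progression a b ∩ Set.Iio (g ^ M)).ncard + b := by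
    have hsub : B ⊆ (languageSet X ∩ progression a b ∩ Set.Iio (g ^ M)) ∪ Set.Iio b := by
      rintro k ⟨hkL, hkb, hkM⟩
      rcases lt_or_ge k b with hk | hk
      · exact Or.inr hk
      · obtain ⟨j, hj⟩ := (Nat.modEq_iff_dvd' hk).1 hkb.symm
        exact Or.inl ⟨⟨hkL, j, by omega⟩, hkM⟩
    have hfin : (languageSet X ∩ progression a b ∩ Set.Iio (g ^ M)).Finite :=
      (Set.finite_Iio _).subset Set.inter_subset_right
    refine (Set.ncard_le_ncard hsub (hfin.union (Set.finite_Iio b))).trans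
      ((Set.ncard_union_le _ _).trans ?_)
    rw [← Nat.card_coe_set_eq (Set.Iio b)]
    simp
  have h3 : (Set.Iic K).ncard = K + 1 := by
    rw [← Nat.card_coe_set_eq (Set.Iic K)]
    simp
  rw [Set.ncard_prod, h3] at h1
  refine h1.trans ?_
  rw [mul_assoc]
  refine Nat.mul_le_mul_left _ (h2.trans ?_)
  set C := (languageSet X ∩ progression a b ∩ Set.Iio (g ^ M)).ncard
  have hC1 : C ≤ max 1 C := le_max_right _ _
  have hC2 : b * 1 ≤ b * max 1 C := Nat.mul_le_mul_left _ (le_max_left _ _)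
  rw [add_mul]
  omega

lemma finite_inter_progression_of_forall_not (hg : 2 ≤ g) {a b : ℕ}
    (h : ¬ ∃ w ∈ language X, a - 1 ≤ w.length ∧ wordValue w ≡ b [MOD a]) :
    (languageSet X ∩ progression a b).Finite ∧
      (languageSet X ∩ progression a b).ncard ≤ g ^ a := by
  have hsub : languageSet X ∩ progression a b ⊆ Set.Iio (g ^ a) := by
    rintro _ ⟨⟨w, hw, rfl⟩, k, hk⟩
    by_contra hlt
    refine h ⟨w, hw, ?_, by rw [hk]; simp [Nat.ModEq]⟩
    by_contra hl
    exact hlt ((wordValue_lt hg w).trans_le (Nat.pow_le_pow_right (by omega) (by omega)))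
  refine ⟨(Set.finite_Iio _).subset hsub, (Set.ncard_le_ncard hsub (Set.finite_Iio _)).trans ?_⟩
  rw [← Nat.card_coe_set_eq (Set.Iio _)]
  simp

end Counting

/-! ### From growth rates to mass dimension -/

open Filter Topology

lemma HasMassDim.of_tendsto {A : Set ℕ} {d : ℝ} (h : Tendsto (massRatio A) atTop (𝓝 d)) :
    HasMassDim A d :=
  ⟨h.liminf_eq, h.limsup_eq⟩

lemma tendsto_massRatio_of_finite {A : Set ℕ} (hA : A.Finite) :
    Tendsto (massRatio A) atTop (𝓝 0) := by
  have hlog : Tendsto (fun N : ℕ => Real.log (N : ℝ)) atTop atTop :=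
    Real.tendsto_log_atTop.comp tendsto_natCast_atTop_atTop
  refine ((tendsto_const_nhds (x := Real.log (A.ncard : ℝ))).div_atTop hlog).congr' ?_
  obtain ⟨M, hM⟩ := hA.bddAbove
  filter_upwards [eventually_gt_atTop M] with N hN
  have : A ∩ Set.Iio N = A := Set.inter_eq_left.2 fun k hk => (hM hk).trans_lt hN
  rw [massRatio, this]

lemma log_natCast_eq_log_max (n : ℕ) : Real.log (n : ℝ) = Real.log ((max 1 n : ℕ) : ℝ) := by
  rcases Nat.eq_zero_or_pos n with rfl | hn
  · simp
  · rw [max_eq_right hn]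

lemma tendsto_natLog_atTop {g : ℕ} (hg : 2 ≤ g) : Tendsto (Nat.log g) atTop atTop := by
  refine tendsto_atTop.2 fun n => ?_
  filter_upwards [eventually_ge_atTop (g ^ n)] with N hN
  exact Nat.le_log_of_pow_le hg hN

lemma tendsto_log_add_one_div : Tendsto (fun n : ℕ => Real.log ((n : ℝ) + 1) / n) atTop (𝓝 0) := by
  have h1 : Tendsto (fun x : ℝ => Real.log x / x) atTop (𝓝 0) := by
    simpa using Real.tendsto_pow_log_div_mul_add_atTop 1 0 1 one_ne_zero
  have h2 : Tendsto (fun n : ℕ => Real.log ((n : ℝ) + 1) / ((n : ℝ) + 1)) atTop (𝓝 0) :=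
    h1.comp (tendsto_atTop_add_const_right _ 1 tendsto_natCast_atTop_atTop)
  have h3 : Tendsto (fun n : ℕ => ((n : ℝ) + 1) / n) atTop (𝓝 1) := by
    have := (tendsto_natCast_div_add_atTop (1 : ℝ)).inv₀ one_ne_zero
    simpa using this
  refine (by simpa using h2.mul h3 : Tendsto _ _ (𝓝 (0 : ℝ))).congr fun n => ?_
  have : (n : ℝ) + 1 ≠ 0 := by positivity
  field_simp

/-- A set whose counting function at `g ^ n` is comparable to a sequence `p n` of growth rate `h`
has mass dimension `h / log g`. -/
lemma tendsto_massRatio {g : ℕ} (hg : 2 ≤ g) {p : ℕ → ℕ} (hp : ∀ n, 1 ≤ p n) {h : ℝ}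
    (hh : Tendsto (fun n : ℕ => Real.log (p n : ℝ) / n) atTop (𝓝 h)) {A : Set ℕ}
    (hupper : ∀ n, (A ∩ Set.Iio (g ^ n)).ncard ≤ (n + 1) * p n)
    (hlower : ∃ c K : ℕ, 1 ≤ c ∧ ∀ n, p n ≤ c * max 1 (A ∩ Set.Iio (g ^ (n + K))).ncard) :
    Tendsto (massRatio A) atTop (𝓝 (h / Real.log g)) := by
  obtain ⟨c, K, hc, hlower⟩ := hlower
  have hlogg : 0 < Real.log (g : ℝ) := Real.log_pos (by exact_mod_cast hg)
  have hmono : ∀ {M N : ℕ}, M ≤ N → (A ∩ Set.Iio M).ncard ≤ (A ∩ Set.Iio N).ncard :=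
    fun hMN => Set.ncard_le_ncard (Set.inter_subset_inter_right _ (Set.Iio_subset_Iio hMN))
      ((Set.finite_Iio _).subset Set.inter_subset_right)
  have hratio : Tendsto (fun n : ℕ => ((n : ℝ) + 1) / n) atTop (𝓝 1) := by
    have := (tendsto_natCast_div_add_atTop (1 : ℝ)).inv₀ one_ne_zero
    simpa using this
  -- Bounds for the ratio at `N` with `g ^ n ≤ N < g ^ (n + 1)`: `U` counts up to `g ^ (n + 1)`, `L`
  -- uses words of length `n - K`, whose images lie below `g ^ n`.
  let U : ℕ → ℝ := fun n =>
    (Real.log (((n + 1 : ℕ) : ℝ) + 1) + Real.log (p (n + 1) : ℝ)) / (n * Real.log g)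
  let L : ℕ → ℝ := fun n => (Real.log (p (n - K) : ℝ) - Real.log c) / ((n + 1) * Real.log g)
  have hU : Tendsto U atTop (𝓝 (h / Real.log g)) := by
    have h1 := ((tendsto_log_add_one_div.add hh).comp (tendsto_add_atTop_nat 1)).mul hratio
    have h2 := h1.div_const (Real.log g)
    rw [zero_add, mul_one] at h2
    refine h2.congr' ?_
    filter_upwards [eventually_gt_atTop 0] with n hn
    have hn' : (n : ℝ) ≠ 0 := by exact_mod_cast hn.ne'
    have hn'' : (n : ℝ) + 1 ≠ 0 := by positivity
    simp only [Function.comp_apply, U]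
    push_cast
    field_simp
  have hL : Tendsto L atTop (𝓝 (h / Real.log g)) := by
    rw [← tendsto_add_atTop_iff_nat K]
    have h1 : Tendsto (fun n : ℕ => (n : ℝ) / (n + (K + 1 : ℝ))) atTop (𝓝 1) :=
      tendsto_natCast_div_add_atTop _
    have h2 : Tendsto (fun n : ℕ => Real.log c / (n : ℝ)) atTop (𝓝 0) :=
      tendsto_const_nhds.div_atTop tendsto_natCast_atTop_atTop
    have h3 := ((hh.sub h2).mul h1).div_const (Real.log g)
    rw [sub_zero, mul_one] at h3
    refine h3.congr' ?_
    filter_upwards [eventually_gt_atTop 0] with n hn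
    have hn' : (n : ℝ) ≠ 0 := by exact_mod_cast hn.ne'
    have hn'' : (n : ℝ) + (K + 1) ≠ 0 := by positivity
    have hn''' : (n : ℝ) + K + 1 ≠ 0 := by positivity
    simp only [L, Nat.add_sub_cancel]
    push_cast
    field_simp
    ring
  refine tendsto_of_tendsto_of_tendsto_of_le_of_le' (hL.comp (tendsto_natLog_atTop hg))
    (hU.comp (tendsto_natLog_atTop hg)) ?_ ?_
  · filter_upwards [eventually_ge_atTop (g ^ (K + 1))] with N hN
    have hn : K + 1 ≤ Nat.log g N := Nat.le_log_of_pow_le hg hN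
    have hN0 : N ≠ 0 := by
      have : 0 < g ^ (K + 1) := by positivity
      omega
    simp only [Function.comp_apply, L, massRatio]
    set n := Nat.log g N
    set C := (A ∩ Set.Iio N).ncard
    have h1 : p (n - K) ≤ c * max 1 C := by
      refine (hlower (n - K)).trans (Nat.mul_le_mul_left _ (max_le_max_left _ (hmono ?_)))
      rw [Nat.sub_add_cancel (by omega)]
      exact Nat.pow_log_le_self g hN0
    have h2 : Real.log (p (n - K) : ℝ) - Real.log c ≤ Real.log C := by
      rw [log_natCast_eq_log_max C, sub_le_iff_le_add', ← Real.log_mul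
        (by exact_mod_cast (by omega : c ≠ 0)) (by exact_mod_cast (by omega : max 1 C ≠ 0))]
      exact Real.log_le_log (by exact_mod_cast hp _) (by exact_mod_cast h1)
    have hN2 : 1 < N := (Nat.one_lt_pow (by omega) (by omega)).trans_le hN
    have h3 : 0 < Real.log (N : ℝ) := Real.log_pos (by exact_mod_cast hN2)
    have h4 : Real.log (N : ℝ) ≤ (n + 1) * Real.log g := by
      have := Real.log_le_log (by exact_mod_cast hN0.bot_lt)
        (by exact_mod_cast (Nat.lt_pow_succ_log_self (b := g) hg N).le :
          (N : ℝ) ≤ (g : ℝ) ^ (n + 1))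
      rw [Real.log_pow] at this
      exact_mod_cast this
    calc _ ≤ Real.log C / ((n + 1) * Real.log g) := by gcongr
      _ ≤ _ := div_le_div_of_nonneg_left (Real.log_natCast_nonneg _) h3 h4
  · filter_upwards [eventually_ge_atTop g] with N hN
    have hn : 1 ≤ Nat.log g N := Nat.le_log_of_pow_le hg (by simpa using hN)
    have hN0 : N ≠ 0 := by omega
    simp only [Function.comp_apply, U, massRatio]
    set n := Nat.log g N
    set C := (A ∩ Set.Iio N).ncard
    have h1 : max 1 C ≤ (n + 1 + 1) * p (n + 1) :=
      max_le (Nat.mul_pos (by omega) (hp _))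
        ((hmono (Nat.lt_pow_succ_log_self (b := g) hg N).le).trans (hupper _))
    have h2 : Real.log C ≤ Real.log (((n + 1 : ℕ) : ℝ) + 1) + Real.log (p (n + 1) : ℝ) := by
      rw [log_natCast_eq_log_max C, ← Real.log_mul (by positivity)
        (by exact_mod_cast (by have := hp (n + 1); omega : p (n + 1) ≠ 0))]
      exact Real.log_le_log (by exact_mod_cast (by omega : 0 < max 1 C)) (by exact_mod_cast h1)
    have h4 : n * Real.log g ≤ Real.log (N : ℝ) := by
      rw [← Real.log_pow]
      exact Real.log_le_log (by positivity) (by exact_mod_cast Nat.pow_log_le_self g hN0)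
    have h5 : 0 < n * Real.log g := mul_pos (by exact_mod_cast hn) hlogg
    calc _ ≤ Real.log C / (n * Real.log g) :=
          div_le_div_of_nonneg_left (Real.log_natCast_nonneg _) h5 h4
      _ ≤ _ := by gcongr

lemma exists_tendsto_log_ncard_wordsOfLength {g : ℕ} {X : Subshift (Fin g) ℕ}
    (hne : (language X).Nonempty) :
    ∃ h : ℝ, Tendsto (fun n : ℕ => Real.log ((wordsOfLength X n).ncard : ℝ) / n) atTop (𝓝 h) := by
  have hpos : ∀ n, (0 : ℝ) < (wordsOfLength X n).ncard := fun n => by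
    exact_mod_cast ncard_wordsOfLength_pos hne n
  have hsub : Subadditive fun n => Real.log ((wordsOfLength X n).ncard : ℝ) := fun m n => by
    rw [← Real.log_mul (hpos m).ne' (hpos n).ne']
    exact Real.log_le_log (hpos _) (by exact_mod_cast ncard_wordsOfLength_add_le m n)
  refine ⟨_, hsub.tendsto_lim ⟨0, ?_⟩⟩
  rintro _ ⟨n, rfl⟩
  exact div_nonneg (Real.log_natCast_nonneg _) n.cast_nonneg

lemma exists_hasMassDim_languageSet {g : ℕ} (hg : 2 ≤ g) {X : Subshift (Fin g) ℕ}
    (htrans : IsTransitive X) (hX : IsSofic X) :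
    ∃ d : ℝ, HasMassDim (languageSet X) d ∧ ∀ a b : ℕ, 1 ≤ a →
      (∃ w ∈ language X, a - 1 ≤ w.length ∧ wordValue w ≡ b [MOD a]) →
      HasMassDim (languageSet X ∩ progression a b) d := by
  -- The empty subshift is not excluded; there log p(n) / n carries no information, and the
  -- dimension is 0.
  rcases (language X).eq_empty_or_nonempty with he | hne
  · refine ⟨0, .of_tendsto (tendsto_massRatio_of_finite (by simp [languageSet, he])), ?_⟩
    rintro a b - ⟨w, hw, -⟩
    simp [he] at hw
  obtain ⟨h, hh⟩ := exists_tendsto_log_ncard_wordsOfLength hne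
  have hp := ncard_wordsOfLength_pos hne
  refine ⟨h / Real.log g, .of_tendsto (tendsto_massRatio hg hp hh
    ncard_languageSet_inter_le ⟨1, 0, le_rfl, fun n => ?_⟩), ?_⟩
  · rw [one_mul, add_zero]
    exact (ncard_wordsOfLength_le hg n).trans (le_max_right _ _)
  · rintro a b ha ⟨w, hw, hwl, hwb⟩
    refine .of_tendsto (tendsto_massRatio hg hp hh (fun n => ?_)
      (ncard_wordsOfLength_le_of_modEq hg htrans hX ha hw hwl hwb))
    exact (Set.ncard_le_ncard (Set.inter_subset_inter_left _ Set.inter_subset_left)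
      ((Set.finite_Iio _).subset Set.inter_subset_right)).trans (ncard_languageSet_inter_le n)

end MassDimSofic

theorem mainTheorem5 (g : ℕ) (hg : 2 ≤ g)
    (X : SymbolicDynamics.FullShift.Subshift (Fin g) ℕ)
    (htrans : MassDimSofic.IsTransitive X) (hsofic : MassDimSofic.IsSofic X) :
    (∀ a b : ℕ, 1 ≤ a →
      (∃ w ∈ MassDimSofic.language X,
        a - 1 ≤ w.length ∧ MassDimSofic.wordValue w ≡ b [MOD a]) →
      ∃ d : ℝ, MassDimSofic.HasMassDim (MassDimSofic.languageSet X) d ∧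
        MassDimSofic.HasMassDim
          (MassDimSofic.languageSet X ∩ MassDimSofic.progression a b) d) ∧
    (∀ a b : ℕ, 1 ≤ a →
      (¬ ∃ w ∈ MassDimSofic.language X,
        a - 1 ≤ w.length ∧ MassDimSofic.wordValue w ≡ b [MOD a]) →
      (MassDimSofic.languageSet X ∩ MassDimSofic.progression a b).Finite ∧
        (MassDimSofic.languageSet X ∩ MassDimSofic.progression a b).ncard ≤ g ^ a) ∧
    (∃ d : ℝ, MassDimSofic.HasMassDim (MassDimSofic.languageSet X) d ∧
      ∀ a b : ℕ, 1 ≤ a →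
        MassDimSofic.HasMassDim
            (MassDimSofic.languageSet X ∩ MassDimSofic.progression a b) 0 ∨
          MassDimSofic.HasMassDim
            (MassDimSofic.languageSet X ∩ MassDimSofic.progression a b) d) := by
  obtain ⟨d, hd, hprog⟩ := MassDimSofic.exists_hasMassDim_languageSet hg htrans hsofic
  refine ⟨fun a b ha h => ⟨d, hd, hprog a b ha h⟩,
    fun a b _ h => MassDimSofic.finite_inter_progression_of_forall_not hg h,
    d, hd, fun a b ha => ?_⟩
  by_cases h : ∃ w ∈ MassDimSofic.language X,
      a - 1 ≤ w.length ∧ MassDimSofic.wordValue w ≡ b [MOD a]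
  · exact Or.inr (hprog a b ha h)
  · exact Or.inl (.of_tendsto (MassDimSofic.tendsto_massRatio_of_finite
      (MassDimSofic.finite_inter_progression_of_forall_not hg h).1))
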